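/- For integers $n\ge 1$ and $0\le a\le b$ with $2(a+b)\le n-1$, let $T(n,a,b)$ be the hypergraph on $n$ vertices (a hypertree) obtained from the path $v_1v_2\cdots v_{n-a-b}$, with edges $e_i=\{v_i,v_{i+1}\}$ for $1\le i\le n-a-b-1$, by inserting a new vertex $w_i$ into $e_i$ (so that $e_i$ becomes $\{v_i,v_{i+1},w_i\}$) for each $i\in\{1,\dots,a\}\cup\{n-a-2b,\dots,n-a-b-1\}$. For a connected hypergraph $G$, a loose path of length $p\ge 0$ from $u$ to $v$ is a sequence $(x_0,f_1,x_1,\dots,x_{p-1},f_p,x_p)$ of distinct vertices $x_0=u,\dots,x_p=v$ and distinct edges $f_1,\dots,f_p$ with $x_{i-1},x_i\in f_i$ for all $i$ and $f_i\cap f_j=\emptyset$ whenever $j>i+1$; the distance $d_G(u,v)$ is the smallest length of a loose path from $u$ to $v$; and the distance spectral radius $\rho(G)$ is the largest eigenvalue of the distance matrix $D(G)=(d_G(u,v))_{u,v\in V(G)}$. Let $n,a,b$ be integers with $a\ge 0$, $b\ge a+2$ and $2(a+b)<n-1$. Then $$\rho\bigl(T(n,a+1,b-1)\bigr)>\rho\bigl(T(n,a,b)\bigr).$$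 -/

import Mathlib

namespace Hypergraph

open scoped Hypergraph

/-- The vertices `x 0, …, x p` and the edges `e 0, …, e (p - 1)` of `H` form the loose path
`(x 0, e 0, x 1, …, x (p - 1), e (p - 1), x p)` of length `p`: the vertices are distinct, the edges
are distinct, `x k` and `x (k + 1)` lie in `e k`, and edges that are not consecutive are
disjoint. -/
structure IsLoosePath {α : Type*} (H : Hypergraph α) {p : ℕ}
    (x : Fin (p + 1) → α) (e : Fin p → Set α) : Prop where
  vertex_mem : ∀ k, x k ∈ V(H)
  edge_mem : ∀ k, e k ∈ E(H)
  vertex_injective : Function.Injective x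
  edge_injective : Function.Injective e
  left_mem : ∀ k : Fin p, x k.castSucc ∈ e k
  right_mem : ∀ k : Fin p, x k.succ ∈ e k
  disjoint : ∀ i j : Fin p, (i : ℕ) + 1 < j → Disjoint (e i) (e j)

/-- There is a loose path of length `p` from `u` to `v` in `H`. -/
def HasLoosePath {α : Type*} (H : Hypergraph α) (u v : α) (p : ℕ) : Prop :=
  ∃ (x : Fin (p + 1) → α) (e : Fin p → Set α),
    H.IsLoosePath x e ∧ x 0 = u ∧ x (Fin.last p) = v

/-- The distance between two vertices of a connected hypergraph: the length of a shortest loose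
path connecting them. -/
noncomputable def dist {α : Type*} (H : Hypergraph α) (u v : α) : ℕ :=
  sInf {p : ℕ | H.HasLoosePath u v p}

/-- The distance matrix of a hypergraph. -/
noncomputable def distMatrix {α : Type*} (H : Hypergraph α) : Matrix V(H) V(H) ℝ :=
  Matrix.of fun u v => (H.dist u v : ℝ)

/-- The distance spectral radius of a hypergraph on finitely many vertices: the largest eigenvalue
of its distance matrix. -/
noncomputable def distSpectralRadius {α : Type*} (H : Hypergraph α) [Fintype V(H)] : ℝ :=
  sSup {μ : ℝ | Module.End.HasEigenvalue H.distMatrix.mulVecLin μ}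

theorem HasLoosePath.symm {α : Type*} {H : Hypergraph α} {u v : α} {p : ℕ}
    (h : H.HasLoosePath u v p) : H.HasLoosePath v u p := by
  obtain ⟨x, e, h, rfl, rfl⟩ := h
  refine ⟨fun k => x k.rev, fun k => e k.rev, ⟨fun k => h.vertex_mem _, fun k => h.edge_mem _,
    h.vertex_injective.comp Fin.rev_injective, h.edge_injective.comp Fin.rev_injective,
    fun k => ?_, fun k => ?_, fun i j hij => ?_⟩, by simp, by simp⟩
  · simpa [Fin.rev_castSucc] using h.right_mem k.rev
  · simpa [Fin.rev_succ] using h.left_mem k.rev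
  · refine (h.disjoint j.rev i.rev ?_).symm
    simp only [Fin.val_rev]
    omega

theorem distMatrix_isHermitian {α : Type*} (H : Hypergraph α) : H.distMatrix.IsHermitian := by
  refine Matrix.IsHermitian.ext fun u v => ?_
  have h : H.dist v u = H.dist u v := by
    unfold dist
    congr 1
    ext p
    exact ⟨HasLoosePath.symm, HasLoosePath.symm⟩
  simp [distMatrix, h]

/-- The supremum in the definition of the distance spectral radius is a maximum. -/
theorem isGreatest_distSpectralRadius {α : Type*} (H : Hypergraph α) [Fintype V(H)]
    [Nonempty V(H)] :
    IsGreatest {μ : ℝ | Module.End.HasEigenvalue H.distMatrix.mulVecLin μ}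
      H.distSpectralRadius := by
  classical
  have hfin : {μ : ℝ | Module.End.HasEigenvalue H.distMatrix.mulVecLin μ}.Finite :=
    Module.End.finite_hasEigenvalue _
  have hne : {μ : ℝ | Module.End.HasEigenvalue H.distMatrix.mulVecLin μ}.Nonempty := by
    obtain ⟨u⟩ := ‹Nonempty V(H)›
    refine ⟨H.distMatrix_isHermitian.eigenvalues u, ?_⟩
    refine Module.End.hasEigenvalue_of_hasEigenvector
      (x := ⇑(H.distMatrix_isHermitian.eigenvectorBasis u)) ⟨?_, ?_⟩
    · rw [Module.End.mem_eigenspace_iff]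
      exact H.distMatrix_isHermitian.mulVec_eigenvectorBasis u
    · intro h0
      exact H.distMatrix_isHermitian.eigenvectorBasis.orthonormal.ne_zero u (by ext i; exact congrFun h0 i)
  exact ⟨hne.csSup_mem hfin, fun μ hμ => le_csSup hfin.bddAbove hμ⟩

end Hypergraph

namespace PathHypertree

/-- The vertex `v_i` of the underlying path. -/
abbrev v (i : ℕ) : ℕ ⊕ ℕ := Sum.inl i

/-- The additional vertex `w_i`. -/
abbrev w (i : ℕ) : ℕ ⊕ ℕ := Sum.inr i

/-- The indices `1, …, a` and `n - a - 2 b, …, n - a - b - 1` of the edges of the path into which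
an additional vertex is inserted. -/
def insertIndices (n a b : ℕ) : Set ℕ :=
  Set.Icc 1 a ∪ Set.Icc (n - a - 2 * b) (n - a - b - 1)

/-- The `i`-th edge: `{v_i, v_{i+1}, w_i}` if a vertex is inserted into it, and `{v_i, v_{i+1}}`
otherwise. -/
def edge (n a b i : ℕ) : Set (ℕ ⊕ ℕ) :=
  {v i, v (i + 1)} ∪ {x | i ∈ insertIndices n a b ∧ x = w i}

end PathHypertree

open PathHypertree in
/-- The hypertree `T(n, a, b)`, for `n ≥ 1`, `a ≤ b` and `2 (a + b) ≤ n - 1`: it is obtained from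
the path `v_1 v_2 ⋯ v_{n-a-b}` by inserting a pendant vertex `w_i` into the edge `{v_i, v_{i+1}}`
for `i = 1, …, a, n - a - 2 b, …, n - a - b - 1`. -/
def pathHypertree (n a b : ℕ) : Hypergraph (ℕ ⊕ ℕ) where
  vertexSet := v '' Set.Icc 1 (n - a - b) ∪ w '' insertIndices n a b
  edgeSet := edge n a b '' Set.Icc 1 (n - a - b - 1)
  subset_vertexSet_of_mem_edgeSet' := by
    rintro _ ⟨i, hi, rfl⟩ x hx
    rw [Set.mem_Icc] at hi
    rcases hx with (rfl | rfl) | ⟨hi', rfl⟩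
    · exact Or.inl ⟨i, Set.mem_Icc.2 ⟨hi.1, by omega⟩, rfl⟩
    · exact Or.inl ⟨i + 1, Set.mem_Icc.2 ⟨by omega, by omega⟩, rfl⟩
    · exact Or.inr ⟨i, hi', rfl⟩

noncomputable instance pathHypertree.fintypeVertexSet (n a b : ℕ) :
    Fintype (pathHypertree n a b).vertexSet :=
  Set.Finite.fintype <|
    ((Set.finite_Icc _ _).image _).union (((Set.finite_Icc _ _).union (Set.finite_Icc _ _)).image _)

/-! ### The kernel `min` on the half-line as a Green's function -/

section MinKernel

variable {ι : Type*} [Fintype ι]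

/-! With f = n - a - 2b, both hypertrees have the same path, and they share all vertices except one:
the first has w_f, the second w_{a+1}. Let X, Y be positive eigenvectors for ρ and σ. Pairing the
two eigenequations (`sub_mul_inner_eq`) writes (σ - ρ) times a positive number as Y(w_{a+1}) ∑ s X +
X(w_f) ∑ s Y, where s(x) = d(x, w_{a+1}) - d(x, w_f) and x runs over the common vertices.

The common vertices split into a core, invariant under a reflection exchanging w_{a+1} and w_f, and
a nonempty tail to its right. The function s is odd on the core, so only the odd part δ of the
eigenvector matters there. On the right half, antisymmetrizing the distance turns (|s-t| - |s+t|)/2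
into -min(s, t), the negative of the Green's function of the discrete Laplacian on the half-line.
Hence δ solves a system with matrix M = diag(ρ + height) + min, and s becomes min(·, c), where c is
the offset of w_f.

If M z = min(·, c), a minimum principle gives z ≥ 0 and potential below c from c onwards
(`exists_minKernel_solution`). By symmetry of M, the tail then contributes strictly positively, so
with Q = ∑ z min(·, c) one gets ∑ s X > -Q(ρ) X(w_f) and ∑ s Y > Q(σ) Y(w_{a+1})
(`sum_shift_lower_bound`). If σ ≤ ρ, then Q(ρ) ≤ Q(σ) (`minKernel_mono`), so the right-hand side is
positive while the left-hand side is not. -/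

/-- The second difference of `T ↦ min T s` is minus the indicator function of `s`. -/
theorem min_second_difference (T s : ℕ) :
    ((min (T + 2) s : ℕ) : ℝ) + (min T s : ℕ) - 2 * (min (T + 1) s : ℕ) =
      -(if s = T + 1 then 1 else 0) := by
  rcases lt_trichotomy s (T + 1) with h | h | h
  · rw [min_eq_right (by omega), min_eq_right (by omega), min_eq_right (by omega),
      if_neg (by omega)]
    ring
  · rw [min_eq_right (by omega), min_eq_left (by omega), min_eq_left (by omega), if_pos h]
    push_cast [h]
    ring
  · rw [min_eq_left (by omega), min_eq_left (by omega), min_eq_left (by omega),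
      if_neg (by omega)]
    push_cast
    ring

/-- The potential with source `α` at `c` and sinks `z p` at `t p` for the Green's function
`min`. -/
noncomputable def minPotential (t : ι → ℕ) (α : ℝ) (c : ℕ) (z : ι → ℝ) (T : ℕ) : ℝ :=
  α * (min T c : ℕ) - ∑ p, ((min T (t p) : ℕ) : ℝ) * z p

theorem minPotential_second_difference (t : ι → ℕ) (α : ℝ) (c : ℕ) (z : ι → ℝ) (T : ℕ) :
    minPotential t α c z (T + 2) + minPotential t α c z T - 2 * minPotential t α c z (T + 1) =
      -(α * if c = T + 1 then 1 else 0) + ∑ p, (if t p = T + 1 then 1 else 0) * z p := by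
  have h : ∑ p, (if t p = T + 1 then (1 : ℝ) else 0) * z p =
      -(∑ p, ((min (T + 2) (t p) : ℕ) : ℝ) * z p + ∑ p, ((min T (t p) : ℕ) : ℝ) * z p -
        2 * ∑ p, ((min (T + 1) (t p) : ℕ) : ℝ) * z p) := by
    rw [Finset.mul_sum, ← Finset.sum_add_distrib, ← Finset.sum_sub_distrib,
      ← Finset.sum_neg_distrib]
    refine Finset.sum_congr rfl fun p _ => ?_
    linear_combination z p * min_second_difference T (t p)
  rw [h]
  unfold minPotential
  linear_combination α * min_second_difference T c

theorem minPotential_zero (t : ι → ℕ) (α : ℝ) (c : ℕ) (z : ι → ℝ) :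
    minPotential t α c z 0 = 0 := by
  simp [minPotential]

/-- The potential is constant beyond the source and all sinks; this is what makes its minimum over
the infinite half-line attained. -/
theorem minPotential_range_finite (t : ι → ℕ) (α : ℝ) (c : ℕ) (z : ι → ℝ) :
    (Set.range (minPotential t α c z)).Finite := by
  obtain ⟨B, hcB, hB⟩ : ∃ B, c ≤ B ∧ ∀ p, t p ≤ B :=
    ⟨c + ∑ p, t p, by omega, fun p =>
      (Finset.single_le_sum (fun _ _ => Nat.zero_le _) (Finset.mem_univ p)).trans (by omega)⟩
  refine ((Set.finite_Iic B).image (minPotential t α c z)).subset ?_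
  rintro _ ⟨T, rfl⟩
  rcases le_total T B with h | h
  · exact ⟨T, h, rfl⟩
  · refine ⟨B, Set.mem_Iic.2 le_rfl, ?_⟩
    simp only [minPotential, min_eq_right hcB, min_eq_right (hcB.trans h)]
    congr 1
    exact Finset.sum_congr rfl fun p _ => by
      rw [min_eq_right (hB p), min_eq_right ((hB p).trans h)]

/-- A minimum principle. -/
theorem minPotential_nonneg {t : ι → ℕ} {r : ι → ℝ} (hr : ∀ q, 0 < r q) {α : ℝ} (hα : 0 ≤ α)
    {c : ℕ} {z : ι → ℝ} (hz : ∀ q, r q * z q = minPotential t α c z (t q)) (T : ℕ) :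
    0 ≤ minPotential t α c z T := by
  classical
  set h := minPotential t α c z with hh
  obtain ⟨_, ⟨T₁, rfl⟩, hT₁⟩ := Set.exists_min_image _ id (minPotential_range_finite t α c z)
    (Set.range_nonempty _)
  have hmin : ∃ T₀, ∀ S, h T₀ ≤ h S := ⟨T₁, fun S => hT₁ _ ⟨S, rfl⟩⟩
  by_contra hneg
  rw [not_le] at hneg
  -- Taking the leftmost minimizer makes the step into it strictly decreasing, so the second
  -- difference there is strictly positive.
  have hspec := Nat.find_spec hmin
  have hleast : ∀ S, S < Nat.find hmin → ¬ ∀ S', h S ≤ h S' := fun S hS => Nat.find_min hmin hS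
  generalize Nat.find hmin = T₀ at hspec hleast
  have h0 : h T₀ < 0 := (hspec T).trans_lt hneg
  obtain _ | k := T₀
  · rw [hh, minPotential_zero] at h0
    exact lt_irrefl _ h0
  have hlt : h (k + 1) < h k := by
    by_contra hle
    rw [not_lt] at hle
    exact hleast k (Nat.lt_succ_self k) fun S => hle.trans (hspec S)
  have hd := minPotential_second_difference t α c z k
  rw [← hh] at hd
  -- A sink located at the minimizer has the sign of the potential there, hence is negative; the
  -- second difference would then be at most zero.
  have hs : ∑ p, (if t p = k + 1 then (1 : ℝ) else 0) * z p ≤ 0 := by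
    refine Finset.sum_nonpos fun p _ => ?_
    split_ifs with hp
    · have := hz p
      rw [hp] at this
      have : r p * z p < 0 := this ▸ h0
      rw [one_mul]
      exact (neg_of_mul_neg_right this (hr p).le).le
    · simp
  have hi : 0 ≤ α * (if c = k + 1 then (1 : ℝ) else 0) := by
    split_ifs <;> simp [hα]
  linarith [hspec (k + 2)]

/-- A strong minimum principle: at a zero the sinks vanish, so the second difference is -1 at the
source, impossible for a nonnegative function, and 0 to its right, which would force the preceding
value to vanish too. -/
theorem minPotential_pos {t : ι → ℕ} {r : ι → ℝ} (hr : ∀ q, 0 < r q) {c : ℕ} (hc : 0 < c)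
    {z : ι → ℝ} (hz : ∀ q, r q * z q = minPotential t 1 c z (t q)) {T : ℕ} (hT : c ≤ T) :
    0 < minPotential t 1 c z T := by
  have hnn := minPotential_nonneg hr zero_le_one hz
  have hsum : ∀ k, minPotential t 1 c z (k + 1) = 0 →
      ∑ p, (if t p = k + 1 then (1 : ℝ) else 0) * z p = 0 := by
    intro k hk
    refine Finset.sum_eq_zero fun p _ => ?_
    split_ifs with hp
    · have := hz p
      rw [hp, hk] at this
      rw [one_mul]
      exact (mul_eq_zero.1 this).resolve_left (hr p).ne'
    · simp
  induction T, hT using Nat.le_induction with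
  | base =>
    refine (hnn c).lt_of_ne' fun h0 => ?_
    obtain ⟨k, rfl⟩ := Nat.exists_eq_succ_of_ne_zero hc.ne'
    have hd := minPotential_second_difference t 1 (k + 1) z k
    rw [hsum k h0, if_pos rfl] at hd
    simp only [Nat.succ_eq_add_one] at *
    linarith [hnn k, hnn (k + 2)]
  | succ k hk ih =>
    refine (hnn _).lt_of_ne' fun h0 => ?_
    have hd := minPotential_second_difference t 1 c z k
    rw [hsum k h0, if_neg (by omega)] at hd
    linarith [hnn (k + 2)]

/-- The solution of the linear system with matrix `diagonal r + (min (t q) (t p))` and right-hand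
side `min (t q) c` is nonnegative, and its potential is less than `c`. -/
theorem exists_minKernel_solution (t : ι → ℕ) {r : ι → ℝ} (hr : ∀ q, 0 < r q) {c : ℕ}
    (hc : 0 < c) :
    ∃ z : ι → ℝ, (∀ q, 0 ≤ z q) ∧
      (∀ q, r q * z q + ∑ p, ((min (t q) (t p) : ℕ) : ℝ) * z p = (min (t q) c : ℕ)) ∧
      ∀ T, c ≤ T → ∑ p, ((min T (t p) : ℕ) : ℝ) * z p < c := by
  let N : (ι → ℝ) →ₗ[ℝ] (ι → ℝ) :=
    { toFun := fun z q => r q * z q + ∑ p, ((min (t q) (t p) : ℕ) : ℝ) * z p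
      map_add' := fun z z' => by
        ext q
        simp only [Pi.add_apply, mul_add, Finset.sum_add_distrib]
        ring
      map_smul' := fun s z => by
        ext q
        simp only [Pi.smul_apply, smul_eq_mul, RingHom.id_apply, mul_add, Finset.mul_sum]
        congr 1
        · ring
        · exact Finset.sum_congr rfl fun p _ => by ring }
  have hker : ∀ z, N z = 0 → ∀ q, 0 ≤ z q := by
    intro z h q
    have h1 : ∀ q, r q * z q = minPotential t 0 c z (t q) := fun q => by
      have : r q * z q + ∑ p, ((min (t q) (t p) : ℕ) : ℝ) * z p = 0 := congrFun h q
      simp only [minPotential]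
      linarith
    have h2 := minPotential_nonneg hr le_rfl h1 (t q)
    rw [← h1] at h2
    exact nonneg_of_mul_nonneg_right h2 (hr q)
  -- Nonnegativity of kernel elements, applied to both `z` and `-z`, leaves only zero.
  have hinj : Function.Injective N := by
    rw [injective_iff_map_eq_zero]
    intro z h
    ext q
    refine le_antisymm ?_ (hker z h q)
    have := hker (-z) (by rw [map_neg, h, neg_zero]) q
    simpa using this
  obtain ⟨z, hz⟩ := LinearMap.injective_iff_surjective.1 hinj fun q => ((min (t q) c : ℕ) : ℝ)
  have hz' : ∀ q, r q * z q + ∑ p, ((min (t q) (t p) : ℕ) : ℝ) * z p = (min (t q) c : ℕ) :=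
    fun q => congrFun hz q
  have h1 : ∀ q, r q * z q = minPotential t 1 c z (t q) := fun q => by
    simp only [minPotential]
    linarith [hz' q]
  refine ⟨z, fun q => ?_, hz', fun T hT => ?_⟩
  · have h2 := minPotential_nonneg hr zero_le_one h1 (t q)
    rw [← h1] at h2
    exact nonneg_of_mul_nonneg_right h2 (hr q)
  · have h2 := minPotential_pos hr hc h1 hT
    simp only [minPotential, min_eq_right hT] at h2
    linarith

/-- Symmetry of the matrix `diagonal r + (min (t q) (t p))`. -/
theorem minKernel_symm (t : ι → ℕ) (r x y : ι → ℝ) :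
    ∑ q, x q * (r q * y q + ∑ p, ((min (t q) (t p) : ℕ) : ℝ) * y p) =
      ∑ q, y q * (r q * x q + ∑ p, ((min (t q) (t p) : ℕ) : ℝ) * x p) := by
  simp only [mul_add, Finset.sum_add_distrib, Finset.mul_sum]
  congr 1
  · exact Finset.sum_congr rfl fun q _ => by ring
  · rw [Finset.sum_comm]
    exact Finset.sum_congr rfl fun q _ => Finset.sum_congr rfl fun p _ => by
      rw [min_comm]
      ring

/-- By symmetry of the matrix, `δ` paired with `min (t q) c` equals `z` paired with the right-hand
side for `δ`. The points `τ k` then cost the potential of `z` at `τ k`, which is less than the gain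
`c`. -/
theorem minKernel_lower_bound {κ : Type*} {K : Finset κ} (hK : K.Nonempty) {t : ι → ℕ}
    {r : ι → ℝ} {c : ℕ} {z : ι → ℝ}
    (hz : ∀ q, r q * z q + ∑ p, ((min (t q) (t p) : ℕ) : ℝ) * z p = (min (t q) c : ℕ))
    (hzc : ∀ T, c ≤ T → ∑ p, ((min T (t p) : ℕ) : ℝ) * z p < c)
    {τ : κ → ℕ} (hτ : ∀ k ∈ K, c ≤ τ k) {x : κ → ℝ} (hx : ∀ k ∈ K, 0 < x k) {δ : ι → ℝ} {ω : ℝ}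
    (hδ : ∀ q, r q * δ q + ∑ p, ((min (t q) (t p) : ℕ) : ℝ) * δ p =
      -∑ k ∈ K, ((min (t q) (τ k) : ℕ) : ℝ) * x k - (min (t q) c : ℕ) * ω) :
    -(ω * ∑ q, z q * (min (t q) c : ℕ)) <
      ∑ q, δ q * (min (t q) c : ℕ) + c * ∑ k ∈ K, x k := by
  have h := minKernel_symm t r δ z
  simp only [hz, hδ] at h
  have h1 : ∑ q, z q * (-∑ k ∈ K, ((min (t q) (τ k) : ℕ) : ℝ) * x k - (min (t q) c : ℕ) * ω) =
      -∑ k ∈ K, (∑ p, ((min (τ k) (t p) : ℕ) : ℝ) * z p) * x k -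
        ω * ∑ q, z q * (min (t q) c : ℕ) := by
    simp only [mul_sub, Finset.sum_sub_distrib, mul_neg, Finset.sum_neg_distrib, Finset.mul_sum,
      Finset.sum_mul]
    rw [Finset.sum_comm]
    congr 1
    · congr 1
      exact Finset.sum_congr rfl fun q _ => Finset.sum_congr rfl fun p _ => by
        rw [min_comm]
        ring
    · exact Finset.sum_congr rfl fun q _ => by ring
  have h2 : ∑ k ∈ K, (∑ p, ((min (τ k) (t p) : ℕ) : ℝ) * z p) * x k < c * ∑ k ∈ K, x k := by
    rw [Finset.mul_sum]
    exact Finset.sum_lt_sum_of_nonempty hK fun k hk =>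
      mul_lt_mul_of_pos_right (hzc _ (hτ k hk)) (hx k hk)
  rw [h, h1]
  linarith

/-- Solutions of the system grow when the diagonal decreases. -/
theorem minKernel_mono {t : ι → ℕ} {r r' : ι → ℝ} (hr : ∀ q, r' q ≤ r q) {c : ℕ} {z z' : ι → ℝ}
    (hz0 : ∀ q, 0 ≤ z q) (hz0' : ∀ q, 0 ≤ z' q)
    (hz : ∀ q, r q * z q + ∑ p, ((min (t q) (t p) : ℕ) : ℝ) * z p = (min (t q) c : ℕ))
    (hz' : ∀ q, r' q * z' q + ∑ p, ((min (t q) (t p) : ℕ) : ℝ) * z' p = (min (t q) c : ℕ)) :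
    ∑ q, z q * (min (t q) c : ℕ) ≤ ∑ q, z' q * (min (t q) c : ℕ) := by
  -- Resolvent identity: the two matrices differ only by the diagonal `r - r'`.
  have h : ∑ q, z' q * ((min (t q) c : ℕ) : ℝ) =
      ∑ q, z q * (min (t q) c : ℕ) + ∑ q, (r q - r' q) * (z q * z' q) := by
    have h1 := minKernel_symm t r z' z
    simp only [hz] at h1
    rw [h1, ← Finset.sum_add_distrib]
    refine Finset.sum_congr rfl fun q _ => ?_
    linear_combination z q * hz' q
  rw [h]
  exact le_add_of_nonneg_right (Finset.sum_nonneg fun q _ =>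
    mul_nonneg (sub_nonneg.2 (hr q)) (mul_nonneg (hz0 q) (hz0' q)))

end MinKernel

open scoped Hypergraph

/-! ### Positive eigenvectors for the largest eigenvalue -/

/-- A nonzero maximal-eigenvalue eigenvector of a symmetric matrix with positive off-diagonal
entries can be chosen positive. -/
theorem Matrix.exists_pos_eigenvector {ι : Type*} [Fintype ι] {A : Matrix ι ι ℝ}
    (hA : A.IsHermitian) (hdiag : ∀ u, 0 ≤ A u u) (hoff : ∀ u v, u ≠ v → 0 < A u v) {ρ : ℝ}
    (hρ : IsGreatest {μ : ℝ | Module.End.HasEigenvalue A.mulVecLin μ} ρ) :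
    ∃ x : ι → ℝ, (∀ u, 0 < x u) ∧ ∀ u, ρ * x u = ∑ v, A u v * x v := by
  classical
  have hnn : ∀ u v, 0 ≤ A u v := fun u v => by
    rcases eq_or_ne u v with rfl | h
    · exact hdiag u
    · exact (hoff u v h).le
  obtain ⟨x, hx⟩ := hρ.1.exists_hasEigenvector
  have hx0 := hx.2
  have hxA : ∀ u, ρ * x u = ∑ v, A u v * x v := fun u => by
    have := congrFun (Module.End.mem_eigenspace_iff.1 hx.1) u
    simpa [Matrix.mulVec, dotProduct] using this.symm
  set B : Matrix ι ι ℝ := ρ • (1 : Matrix ι ι ℝ) - A with hB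
  have hBH : B.IsHermitian := by
    refine Matrix.IsHermitian.sub ?_ hA
    rw [Matrix.IsHermitian, Matrix.conjTranspose_smul, Matrix.conjTranspose_one]
    simp
  have hBv : ∀ y : ι → ℝ, B.mulVec y = ρ • y - A.mulVec y := fun y => by
    rw [hB, Matrix.sub_mulVec, Matrix.smul_mulVec, Matrix.one_mulVec]
  have hpsd : B.PosSemidef := by
    rw [hBH.posSemidef_iff_eigenvalues_nonneg]
    intro i
    have h1 := hBH.mulVec_eigenvectorBasis i
    rw [hBv] at h1
    have h2 : Module.End.HasEigenvalue A.mulVecLin (ρ - hBH.eigenvalues i) := by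
      refine Module.End.hasEigenvalue_of_hasEigenvector
        (x := ⇑(hBH.eigenvectorBasis i)) ⟨?_, fun h0 => ?_⟩
      · rw [Module.End.mem_eigenspace_iff, Matrix.mulVecLin_apply, sub_smul, ← h1]
        abel
      · exact hBH.eigenvectorBasis.orthonormal.ne_zero i (by ext j; exact congrFun h0 j)
    have := hρ.2 h2
    simp only [Pi.zero_apply]
    linarith
  have hle : ∀ u, ρ * |x u| ≤ ∑ v, A u v * |x v| := fun u => by
    calc ρ * |x u| ≤ |ρ| * |x u| := by gcongr; exact le_abs_self ρ
      _ = |∑ v, A u v * x v| := by rw [← abs_mul, hxA]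
      _ ≤ ∑ v, |A u v * x v| := Finset.abs_sum_le_sum_abs _ _
      _ = ∑ v, A u v * |x v| := Finset.sum_congr rfl fun v _ => by
        rw [abs_mul, abs_of_nonneg (hnn u v)]
  -- Since ρI - A is positive semidefinite, a vector with nonpositive quadratic form lies in its
  -- kernel; so |x| is again an eigenvector.
  have hq : dotProduct (fun u => |x u|) (B.mulVec fun u => |x u|) ≤ 0 := by
    rw [hBv]
    refine Finset.sum_nonpos fun u _ => mul_nonpos_of_nonneg_of_nonpos (abs_nonneg _) ?_
    simpa [Matrix.mulVec, dotProduct] using hle u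
  have hzero : B.mulVec (fun u => |x u|) = 0 := by
    rw [← hpsd.dotProduct_mulVec_zero_iff]
    refine le_antisymm ?_ (hpsd.dotProduct_mulVec_nonneg _)
    simpa using hq
  have heq : ∀ u, ρ * |x u| = ∑ v, A u v * |x v| := fun u => by
    have := congrFun hzero u
    rw [hBv] at this
    simpa [Matrix.mulVec, dotProduct, sub_eq_zero] using this
  refine ⟨fun u => |x u|, fun u => (abs_nonneg _).lt_of_ne' fun h0 => hx0 ?_, heq⟩
  -- A zero entry makes a sum of nonnegative terms vanish, and positivity off the diagonal then
  -- kills every other entry.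
  have h1 := heq u
  rw [h0, mul_zero, eq_comm, Finset.sum_eq_zero_iff_of_nonneg
    fun v _ => mul_nonneg (hnn u v) (abs_nonneg _)] at h1
  ext v
  rcases eq_or_ne u v with rfl | h
  · exact abs_eq_zero.1 h0
  · have := h1 v (Finset.mem_univ v)
    exact abs_eq_zero.1 ((mul_eq_zero.1 this).resolve_left (hoff u v h).ne')

/-! ### Distances in the hypertree -/

namespace PathHypertree

/-- The index of the leftmost path edge on which a loose path to the right starting from a vertex
begins. -/
def lo : ℕ ⊕ ℕ → ℕ := Sum.elim id id

/-- One more than the index of the path edge on which a loose path from the left to a vertex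
ends. -/
def hi : ℕ ⊕ ℕ → ℕ := Sum.elim id (· + 1)

theorem lo_v (i : ℕ) : lo (v i) = i := rfl

theorem lo_w (i : ℕ) : lo (w i) = i := rfl

theorem hi_v (i : ℕ) : hi (v i) = i := rfl

theorem hi_w (i : ℕ) : hi (w i) = i + 1 := rfl

theorem mem_edge_iff {n a b i : ℕ} {x : ℕ ⊕ ℕ} :
    x ∈ edge n a b i ↔ x = v i ∨ x = v (i + 1) ∨ i ∈ insertIndices n a b ∧ x = w i := by
  simp [edge, or_assoc]

theorem lo_hi_of_mem_edge {n a b i : ℕ} {x : ℕ ⊕ ℕ} (h : x ∈ edge n a b i) :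
    i ≤ lo x ∧ lo x ≤ i + 1 ∧ i ≤ hi x ∧ hi x ≤ i + 1 := by
  rw [mem_edge_iff] at h
  rcases h with rfl | rfl | ⟨-, rfl⟩ <;> simp only [lo_v, lo_w, hi_v, hi_w] <;> omega

theorem v_mem_edge (n a b i : ℕ) : v i ∈ edge n a b i := mem_edge_iff.2 (Or.inl rfl)

theorem v_succ_mem_edge (n a b i : ℕ) : v (i + 1) ∈ edge n a b i :=
  mem_edge_iff.2 (Or.inr (Or.inl rfl))

theorem edge_injective (n a b : ℕ) : Function.Injective (edge n a b) := by
  have h : ∀ i j, edge n a b i = edge n a b j → j ≤ i := fun i j hij => by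
    have := (lo_hi_of_mem_edge (hij ▸ v_mem_edge n a b i)).1
    exact this
  exact fun i j hij => le_antisymm (h j i hij.symm) (h i j hij)

theorem disjoint_edge {n a b i j : ℕ} (hij : i + 1 < j) :
    Disjoint (edge n a b i) (edge n a b j) := by
  rw [Set.disjoint_left]
  intro x hi hj
  have h1 := lo_hi_of_mem_edge hi
  have h2 := lo_hi_of_mem_edge hj
  omega

theorem mem_vertexSet_iff {n a b : ℕ} {x : ℕ ⊕ ℕ} :
    x ∈ V(pathHypertree n a b) ↔ (∃ i, 1 ≤ i ∧ i ≤ n - a - b ∧ x = v i) ∨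
      ∃ i ∈ insertIndices n a b, x = w i := by
  simp only [pathHypertree, Set.mem_union, Set.mem_image, Set.mem_Icc, and_assoc, eq_comm]

section Dist

variable {n a b : ℕ} {u y : ℕ ⊕ ℕ}

theorem one_le_lo (hn : a + 2 * b < n) (hu : u ∈ V(pathHypertree n a b)) : 1 ≤ lo u := by
  rw [mem_vertexSet_iff] at hu
  rcases hu with ⟨i, h1, -, rfl⟩ | ⟨i, h, rfl⟩
  · exact h1
  · simp only [insertIndices, Set.mem_union, Set.mem_Icc] at h
    rw [lo_w]
    omega

theorem hi_le (hn : 2 * a + b < n) (hu : u ∈ V(pathHypertree n a b)) : hi u ≤ n - a - b := by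
  rw [mem_vertexSet_iff] at hu
  rcases hu with ⟨i, -, h2, rfl⟩ | ⟨i, h, rfl⟩
  · exact h2
  · simp only [insertIndices, Set.mem_union, Set.mem_Icc] at h
    rw [hi_w]
    omega

theorem mem_edge_lo (hu : u ∈ V(pathHypertree n a b)) : u ∈ edge n a b (lo u) := by
  rw [mem_vertexSet_iff] at hu
  rcases hu with ⟨i, -, -, rfl⟩ | ⟨i, h, rfl⟩
  · exact v_mem_edge n a b i
  · exact mem_edge_iff.2 (Or.inr (Or.inr ⟨h, rfl⟩))

theorem mem_edge_of_hi {j : ℕ} (hu : u ∈ V(pathHypertree n a b)) (hj : hi u = j + 1) :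
    u ∈ edge n a b j := by
  rw [mem_vertexSet_iff] at hu
  rcases hu with ⟨i, -, -, rfl⟩ | ⟨i, h, rfl⟩
  · rw [hi_v] at hj
    exact hj ▸ v_succ_mem_edge n a b j
  · rw [hi_w, Nat.add_right_cancel_iff] at hj
    exact hj ▸ mem_edge_iff.2 (Or.inr (Or.inr ⟨h, rfl⟩))

/-- The path uses the consecutive edges from index `lo u` to `hi y - 1`, passing through path
vertices in between. -/
theorem hasLoosePath_of_lo_lt_hi (hn : 2 * (a + b) < n) (hu : u ∈ V(pathHypertree n a b))
    (hy : y ∈ V(pathHypertree n a b)) (huy : u ≠ y) (h : lo u < hi y) :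
    (pathHypertree n a b).HasLoosePath u y (hi y - lo u) := by
  obtain ⟨p, hp⟩ : ∃ p, hi y = lo u + p + 1 := ⟨hi y - lo u - 1, by omega⟩
  have h1 := one_le_lo (by omega) hu
  have h2 := hi_le (by omega) hy
  have hin : ∀ k, 0 < k → k < p + 1 → v (lo u + k) ≠ u ∧ v (lo u + k) ≠ y := by
    intro k hk hkp
    constructor
    · intro h0
      have := congrArg lo h0
      rw [lo_v] at this
      omega
    · intro h0
      have := congrArg hi h0
      rw [hi_v] at this
      omega
  rw [show hi y - lo u = p + 1 by omega]
  refine ⟨fun k => if (k : ℕ) = 0 then u else if (k : ℕ) = p + 1 then y else v (lo u + k),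
    fun k => edge n a b (lo u + k), ⟨fun k => ?_, fun k => ?_, fun k l hkl => ?_, fun k l hkl => ?_,
    fun k => ?_, fun k => ?_, fun i j hij => ?_⟩, by simp, by simp⟩
  · split_ifs
    · exact hu
    · exact hy
    · exact mem_vertexSet_iff.2 (Or.inl ⟨_, by omega, by omega, rfl⟩)
  · exact ⟨_, Set.mem_Icc.2 ⟨by omega, by omega⟩, rfl⟩
  · apply Fin.ext
    have hk := k.isLt
    have hl := l.isLt
    split_ifs at hkl with c1 c2 c3 c4 c5 c6 c7 c8
    · omega
    · exact absurd hkl huy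
    · exact absurd hkl.symm (hin l (by omega) (by omega)).1
    · exact absurd hkl.symm huy
    · omega
    · exact absurd hkl.symm (hin l (by omega) (by omega)).2
    · exact absurd hkl (hin k (by omega) (by omega)).1
    · exact absurd hkl (hin k (by omega) (by omega)).2
    · have := congrArg lo hkl
      rw [lo_v, lo_v] at this
      omega
  · have := edge_injective n a b hkl
    exact Fin.ext (by omega)
  · simp only [Fin.val_castSucc]
    split_ifs with c1 c2
    · rw [c1]
      exact mem_edge_lo hu
    · omega
    · exact v_mem_edge n a b _
  · simp only [Fin.val_succ]
    rw [if_neg (by omega)]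
    split_ifs with c1
    · exact mem_edge_of_hi hy (by omega)
    · exact v_succ_mem_edge n a b _
  · exact disjoint_edge (by omega)

/-- Consecutive edges of a loose path share a vertex, so the edge index rises by at most one per
step. -/
theorem hi_sub_lo_le_of_hasLoosePath (huy : u ≠ y) {q : ℕ}
    (h : (pathHypertree n a b).HasLoosePath u y q) : hi y - lo u ≤ q := by
  obtain ⟨x, e, hp, rfl, rfl⟩ := h
  obtain _ | q := q
  · exact absurd rfl huy
  choose g _ hge using hp.edge_mem
  have hmem : ∀ k : Fin (q + 1), x k.castSucc ∈ edge n a b (g k) ∧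
      x k.succ ∈ edge n a b (g k) := fun k => by
    rw [hge]
    exact ⟨hp.left_mem k, hp.right_mem k⟩
  have hg : ∀ k (hk : k < q + 1), g ⟨k, hk⟩ ≤ lo (x 0) + k := by
    intro k
    induction k with
    | zero =>
      intro hk
      exact (lo_hi_of_mem_edge (hmem ⟨0, hk⟩).1).1
    | succ k ih =>
      intro hk
      have h1 := (lo_hi_of_mem_edge (hmem ⟨k + 1, hk⟩).1).1
      have h2 := (lo_hi_of_mem_edge (hmem ⟨k, by omega⟩).2).2.1
      have h3 := ih (by omega)
      have h4 : (⟨k + 1, hk⟩ : Fin (q + 1)).castSucc = (⟨k, by omega⟩ : Fin (q + 1)).succ := rfl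
      rw [h4] at h1
      omega
  have h1 := hg q (by omega)
  have h2 : hi (x (Fin.last (q + 1))) ≤ g (Fin.last q) + 1 :=
    (lo_hi_of_mem_edge (hmem (Fin.last q)).2).2.2.2
  have h3 : g (Fin.last q) ≤ lo (x 0) + q := h1
  omega

theorem dist_of_lo_lt_hi (hn : 2 * (a + b) < n) (hu : u ∈ V(pathHypertree n a b))
    (hy : y ∈ V(pathHypertree n a b)) (huy : u ≠ y) (h : lo u < hi y) :
    (pathHypertree n a b).dist u y = hi y - lo u := by
  have h1 := hasLoosePath_of_lo_lt_hi hn hu hy huy h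
  exact le_antisymm (Nat.sInf_le h1)
    (le_csInf ⟨_, h1⟩ fun q hq => hi_sub_lo_le_of_hasLoosePath huy hq)

theorem dist_self (hu : u ∈ V(pathHypertree n a b)) : (pathHypertree n a b).dist u u = 0 := by
  refine Nat.eq_zero_of_le_zero (Nat.sInf_le ⟨fun _ => u, Fin.elim0, ⟨fun _ => hu,
    fun k => k.elim0, fun k l _ => Subsingleton.elim (α := Fin 1) k l, fun k => k.elim0,
    fun k => k.elim0, fun k => k.elim0, fun i => i.elim0⟩, rfl, rfl⟩)

end Dist

/-! ### Distances as positions on a line plus heights -/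

/-- Twice the position of a vertex on the line through the path; the vertex `w_i` sits between
`v_i` and `v_{i+1}`. -/
def pos (x : ℕ ⊕ ℕ) : ℤ := lo x + hi x

/-- Twice the height of a vertex above the line through the path. -/
def height (x : ℕ ⊕ ℕ) : ℤ := hi x - lo x

/-- The distance of two vertices, expressed through positions and heights. -/
noncomputable def lineDist (x y : ℕ ⊕ ℕ) : ℝ :=
  if x = y then 0 else ((|pos x - pos y| + height x + height y : ℤ) : ℝ) / 2

theorem lineDist_self (x : ℕ ⊕ ℕ) : lineDist x x = 0 := if_pos rfl

theorem lineDist_of_ne {x y : ℕ ⊕ ℕ} (h : x ≠ y) :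
    lineDist x y = ((|pos x - pos y| + height x + height y : ℤ) : ℝ) / 2 := if_neg h

theorem lineDist_comm (x y : ℕ ⊕ ℕ) : lineDist x y = lineDist y x := by
  rcases eq_or_ne x y with rfl | h
  · rfl
  · rw [lineDist_of_ne h, lineDist_of_ne h.symm, abs_sub_comm, add_right_comm]

theorem pos_v (i : ℕ) : pos (v i) = 2 * i := by
  rw [pos, lo_v, hi_v]
  omega

theorem pos_w (i : ℕ) : pos (w i) = 2 * i + 1 := by
  rw [pos, lo_w, hi_w]
  omega

theorem height_v (i : ℕ) : height (v i) = 0 := by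
  rw [height, lo_v, hi_v]
  omega

theorem height_w (i : ℕ) : height (w i) = 1 := by
  rw [height, lo_w, hi_w]
  omega

theorem height_nonneg (x : ℕ ⊕ ℕ) : 0 ≤ height x := by
  rcases x with i | i
  · exact (height_v i).ge
  · rw [height_w]
    exact zero_le_one

theorem pos_eq_or (x : ℕ ⊕ ℕ) : lo x = hi x ∧ x = v (lo x) ∨ hi x = lo x + 1 ∧ x = w (lo x) := by
  rcases x with i | i
  · exact Or.inl ⟨rfl, rfl⟩
  · exact Or.inr ⟨rfl, rfl⟩

theorem pos_injective : Function.Injective pos := by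
  rintro (i | i) (j | j) h <;> simp only [pos_v, pos_w] at h <;> first | omega | (congr 1; omega)

theorem lineDist_of_lo_lt_hi {x y : ℕ ⊕ ℕ} (h : x ≠ y) (hl : lo x < hi y) :
    lineDist x y = (hi y - lo x : ℕ) := by
  rw [lineDist_of_ne h]
  have h1 : |pos x - pos y| + height x + height y = 2 * (hi y - lo x : ℕ) := by
    rw [abs_of_nonpos]
    · unfold pos height
      omega
    · have h2 : pos x ≠ pos y := pos_injective.ne h
      unfold pos at *
      rcases pos_eq_or x with ⟨hx, -⟩ | ⟨hx, -⟩ <;> rcases pos_eq_or y with ⟨hy, -⟩ | ⟨hy, -⟩ <;>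
        omega
  rw [h1]
  push_cast
  ring

theorem dist_eq_lineDist {n a b : ℕ} {x y : ℕ ⊕ ℕ} (hn : 2 * (a + b) < n)
    (hx : x ∈ V(pathHypertree n a b)) (hy : y ∈ V(pathHypertree n a b)) :
    ((pathHypertree n a b).dist x y : ℝ) = lineDist x y := by
  rcases eq_or_ne x y with rfl | h
  · rw [dist_self hx, lineDist_self, Nat.cast_zero]
  by_cases hl : lo x < hi y
  · rw [dist_of_lo_lt_hi hn hx hy h hl, lineDist_of_lo_lt_hi h hl]
  · have hl' : lo y < hi x := by
      rcases pos_eq_or x with ⟨h1, h2⟩ | ⟨h1, h2⟩ <;> rcases pos_eq_or y with ⟨h3, h4⟩ | ⟨h3, h4⟩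
      · have : lo x ≠ lo y := fun h5 => h (by rw [h2, h4, h5])
        omega
      all_goals omega
    have hs : (pathHypertree n a b).dist x y = (pathHypertree n a b).dist y x := by
      unfold Hypergraph.dist
      congr 1
      ext p
      exact ⟨Hypergraph.HasLoosePath.symm, Hypergraph.HasLoosePath.symm⟩
    rw [hs, dist_of_lo_lt_hi hn hy hx h.symm hl', lineDist_comm, lineDist_of_lo_lt_hi h.symm hl']

theorem lineDist_pos {x y : ℕ ⊕ ℕ} (h : x ≠ y) : 0 < lineDist x y := by
  rw [lineDist_of_ne h]
  have h1 : 0 < |pos x - pos y| := abs_pos.2 (sub_ne_zero.2 (pos_injective.ne h))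
  have h2 := height_nonneg x
  have h3 := height_nonneg y
  have h4 : (0 : ℝ) < ((|pos x - pos y| + height x + height y : ℤ) : ℝ) := by
    exact_mod_cast (by omega)
  exact half_pos h4

/-- A positive eigenvector of the distance matrix of `T(n, a, b)` for the distance spectral
radius. -/
theorem exists_pos_eigenfunction {n a b : ℕ} (hn : 2 * (a + b) < n) {W : Finset (ℕ ⊕ ℕ)}
    (hW : ∀ x, x ∈ W ↔ x ∈ V(pathHypertree n a b)) (hW2 : W.Nontrivial) :
    0 < (pathHypertree n a b).distSpectralRadius ∧ ∃ X : ℕ ⊕ ℕ → ℝ, (∀ x ∈ W, 0 < X x) ∧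
      ∀ x ∈ W, (pathHypertree n a b).distSpectralRadius * X x = ∑ y ∈ W, lineDist x y * X y := by
  classical
  obtain ⟨x₀, hx₀, y₀, hy₀, hxy₀⟩ := hW2
  have : Nonempty V(pathHypertree n a b) := ⟨⟨x₀, (hW _).1 hx₀⟩⟩
  have hD : ∀ x y : V(pathHypertree n a b),
      (pathHypertree n a b).distMatrix x y = lineDist x y := fun x y =>
    dist_eq_lineDist hn x.2 y.2
  obtain ⟨X, hX, hXe⟩ := Matrix.exists_pos_eigenvector
    (pathHypertree n a b).distMatrix_isHermitian
    (fun x => by rw [hD, lineDist_self])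
    (fun x y hxy => by
      rw [hD]
      exact lineDist_pos fun h => hxy (Subtype.ext h))
    (pathHypertree n a b).isGreatest_distSpectralRadius
  set Y : ℕ ⊕ ℕ → ℝ := fun x => if h : x ∈ V(pathHypertree n a b) then X ⟨x, h⟩ else 0 with hY
  have hYX : ∀ x : V(pathHypertree n a b), Y x = X x := fun x => dif_pos x.2
  have hpos : ∀ x ∈ W, 0 < Y x := fun x hx => by
    rw [hYX ⟨x, (hW x).1 hx⟩]
    exact hX _
  have heq : ∀ x ∈ W, (pathHypertree n a b).distSpectralRadius * Y x =
      ∑ y ∈ W, lineDist x y * Y y := fun x hx => by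
    rw [hYX ⟨x, (hW x).1 hx⟩, hXe]
    simp only [hD, ← hYX]
    exact (Finset.sum_subtype W hW fun y => lineDist x y * Y y).symm
  refine ⟨?_, Y, hpos, heq⟩
  have h1 : 0 < ∑ y ∈ W, lineDist x₀ y * Y y := by
    refine Finset.sum_pos' (fun y hy => ?_)
      ⟨y₀, hy₀, mul_pos (lineDist_pos hxy₀) (hpos _ hy₀)⟩
    rcases eq_or_ne x₀ y with rfl | h
    · rw [lineDist_self, zero_mul]
    · exact (mul_pos (lineDist_pos h) (hpos _ hy)).le
  rw [← heq x₀ hx₀] at h1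
  exact pos_of_mul_pos_left h1 (hpos _ hx₀).le

end PathHypertree

/-! ### The reflection of the core and antisymmetrized distances -/

namespace PathHypertree

/-- The largest subset of the vertices of both `T(n, a, b)` and `T(n, a + 1, b - 1)` that is
symmetric about the midpoint of `v_{a+1}` and `v_{f+1}`, where `f = n - a - 2 b`. -/
def core (a f : ℕ) : Finset (ℕ ⊕ ℕ) :=
  (Finset.Icc 1 (a + f + 1)).disjSum (Finset.Icc 1 a ∪ Finset.Icc (f + 1) (f + a))

/-- The vertices to the right of the core. -/
def tail (a f m : ℕ) : Finset (ℕ ⊕ ℕ) :=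
  (Finset.Icc (a + f + 2) m).disjSum (Finset.Icc (f + a + 1) (m - 1))

/-- The reflection of the core. -/
def reflect (a f : ℕ) : ℕ ⊕ ℕ → ℕ ⊕ ℕ := Sum.map (a + f + 2 - ·) (a + f + 1 - ·)

/-- The signed distance of positions from the centre of the core. -/
def offset (a f : ℕ) (x : ℕ ⊕ ℕ) : ℤ := pos x - (a + f + 2)

/-- The right half of the core. -/
def rightCore (a f : ℕ) : Finset (ℕ ⊕ ℕ) := (core a f).filter fun x => 0 < offset a f x

section Core

variable {a f m : ℕ} {x y : ℕ ⊕ ℕ}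

theorem v_mem_core {i : ℕ} : v i ∈ core a f ↔ 1 ≤ i ∧ i ≤ a + f + 1 := by
  simp [core]

theorem w_mem_core {i : ℕ} :
    w i ∈ core a f ↔ 1 ≤ i ∧ i ≤ a ∨ f + 1 ≤ i ∧ i ≤ f + a := by
  simp [core]

theorem v_mem_tail {i : ℕ} : v i ∈ tail a f m ↔ a + f + 2 ≤ i ∧ i ≤ m := by
  simp [tail]

theorem w_mem_tail {i : ℕ} : w i ∈ tail a f m ↔ f + a + 1 ≤ i ∧ i ≤ m - 1 := by
  simp [tail]

theorem reflect_v (a f i : ℕ) : reflect a f (v i) = v (a + f + 2 - i) := rfl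

theorem reflect_w (a f i : ℕ) : reflect a f (w i) = w (a + f + 1 - i) := rfl

theorem reflect_mem_core (hx : x ∈ core a f) : reflect a f x ∈ core a f := by
  rcases x with i | i
  · rw [v_mem_core] at hx
    rw [reflect_v, v_mem_core]
    omega
  · rw [w_mem_core] at hx
    rw [reflect_w, w_mem_core]
    omega

theorem offset_reflect (hx : x ∈ core a f) : offset a f (reflect a f x) = -offset a f x := by
  rcases x with i | i
  · rw [v_mem_core] at hx
    rw [reflect_v, offset, offset, pos_v, pos_v]
    omega
  · rw [w_mem_core] at hx
    rw [reflect_w, offset, offset, pos_w, pos_w]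
    omega

theorem height_reflect (x : ℕ ⊕ ℕ) : height (reflect a f x) = height x := by
  rcases x with i | i
  · rw [reflect_v, height_v, height_v]
  · rw [reflect_w, height_w, height_w]

theorem offset_injective (a f : ℕ) : Function.Injective (offset a f) := fun _ _ h =>
  pos_injective (by unfold offset at h; omega)

theorem reflect_reflect (hx : x ∈ core a f) : reflect a f (reflect a f x) = x :=
  offset_injective a f (by
    rw [offset_reflect (reflect_mem_core hx), offset_reflect hx, neg_neg])

theorem lineDist_of_ne_offset (h : x ≠ y) :
    lineDist x y =
      ((|offset a f x - offset a f y| + height x + height y : ℤ) : ℝ) / 2 := by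
  rw [lineDist_of_ne h, offset, offset, sub_sub_sub_cancel_right]

theorem lineDist_reflect_reflect (hx : x ∈ core a f) (hy : y ∈ core a f) :
    lineDist (reflect a f x) (reflect a f y) = lineDist x y := by
  rcases eq_or_ne x y with rfl | h
  · rw [lineDist_self, lineDist_self]
  · have h' : reflect a f x ≠ reflect a f y := fun h0 => h (by
      rw [← reflect_reflect hx, h0, reflect_reflect hy])
    rw [lineDist_of_ne_offset (a := a) (f := f) h, lineDist_of_ne_offset (a := a) (f := f) h',
      offset_reflect hx, offset_reflect hy, height_reflect, height_reflect, ← neg_sub',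
      abs_neg]

theorem lineDist_reflect_right (hx : x ∈ core a f) (hy : y ∈ core a f) :
    lineDist x (reflect a f y) = lineDist (reflect a f x) y := by
  rw [← lineDist_reflect_reflect hx (reflect_mem_core hy), reflect_reflect hy]

theorem mem_rightCore : x ∈ rightCore a f ↔ x ∈ core a f ∧ 0 < offset a f x := by
  simp [rightCore]

/-- Pairing an odd function on the core with any function only sees the odd part of the
latter. -/
theorem sum_core_odd {g : ℕ ⊕ ℕ → ℝ} (hg : ∀ x ∈ core a f, g (reflect a f x) = -g x)
    (X : ℕ ⊕ ℕ → ℝ) :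
    ∑ x ∈ core a f, g x * X x = ∑ x ∈ rightCore a f, g x * (X x - X (reflect a f x)) := by
  -- A vertex at the centre is fixed by the reflection, so an odd function vanishes there.
  have h1 : ∑ x ∈ (core a f).filter (fun x => ¬ 0 < offset a f x), g x * X x =
      ∑ x ∈ (core a f).filter (fun x => offset a f x < 0), g x * X x := by
    symm
    refine Finset.sum_subset (fun x hx => ?_) fun x hx hx' => ?_
    · rw [Finset.mem_filter] at hx ⊢
      exact ⟨hx.1, by omega⟩
    · rw [Finset.mem_filter] at hx hx'
      have h0 : offset a f x = 0 := by
        by_contra h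
        exact hx' ⟨hx.1, by omega⟩
      have h2 : reflect a f x = x :=
        offset_injective a f (by rw [offset_reflect hx.1, h0, neg_zero])
      have h3 := hg x hx.1
      rw [h2] at h3
      have h4 : g x = 0 := by linarith
      rw [h4, zero_mul]
  have h2 : ∑ x ∈ (core a f).filter (fun x => offset a f x < 0), g x * X x =
      ∑ x ∈ rightCore a f, g (reflect a f x) * X (reflect a f x) := by
    refine Finset.sum_nbij' (reflect a f) (reflect a f) (fun x hx => ?_) (fun x hx => ?_)
      (fun x hx => ?_) (fun x hx => ?_) fun x hx => ?_
    · rw [Finset.mem_filter] at hx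
      rw [mem_rightCore, offset_reflect hx.1]
      exact ⟨reflect_mem_core hx.1, by omega⟩
    · rw [mem_rightCore] at hx
      rw [Finset.mem_filter, offset_reflect hx.1]
      exact ⟨reflect_mem_core hx.1, by omega⟩
    · exact reflect_reflect (Finset.mem_filter.1 hx).1
    · exact reflect_reflect (mem_rightCore.1 hx).1
    · rw [reflect_reflect (Finset.mem_filter.1 hx).1]
  rw [← Finset.sum_filter_add_sum_filter_not _ (fun x => 0 < offset a f x), h1, h2, ← rightCore,
    ← Finset.sum_add_distrib]
  refine Finset.sum_congr rfl fun x hx => ?_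
  rw [hg x (mem_rightCore.1 hx).1]
  ring

theorem lineDist_sub_lineDist_reflect (hx : x ∈ core a f) (h1 : x ≠ y)
    (h2 : reflect a f x ≠ y) :
    lineDist x y - lineDist (reflect a f x) y =
      ((|offset a f x - offset a f y| - |offset a f x + offset a f y| : ℤ) : ℝ) / 2 := by
  rw [lineDist_of_ne_offset (a := a) (f := f) h1, lineDist_of_ne_offset (a := a) (f := f) h2,
    offset_reflect hx, height_reflect, ← neg_add', abs_neg]
  push_cast
  ring

theorem abs_sub_sub_abs_add {s t : ℤ} (hs : 0 ≤ s) (ht : 0 ≤ t) :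
    ((|s - t| - |s + t| : ℤ) : ℝ) / 2 = -((min s.toNat t.toNat : ℕ) : ℝ) := by
  have h : |s - t| - |s + t| = -(2 * (min s.toNat t.toNat : ℕ)) := by
    rw [abs_of_nonneg (add_nonneg hs ht)]
    rcases le_total s t with h | h
    · rw [abs_of_nonpos (by omega)]
      omega
    · rw [abs_of_nonneg (by omega)]
      omega
  rw [h]
  push_cast
  ring

/-- The heights cancel unless `x = y`, where the distance is 0 instead of the `height x` given by
the formula for distinct vertices. This defect is the origin of the diagonal ρ + height. -/
theorem lineDist_sub_of_offset_pos (hx : x ∈ rightCore a f) (hy : 0 < offset a f y) :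
    lineDist x y - lineDist (reflect a f x) y =
      -((min (offset a f x).toNat (offset a f y).toNat : ℕ) : ℝ) -
        if x = y then (height x : ℝ) else 0 := by
  rw [mem_rightCore] at hx
  have h2 : reflect a f x ≠ y := fun h => by
    have := offset_reflect hx.1
    rw [h] at this
    omega
  split_ifs with h
  · subst h
    rw [lineDist_self, lineDist_of_ne_offset (a := a) (f := f) h2, offset_reflect hx.1,
      height_reflect, min_self]
    have h3 : |-offset a f x - offset a f x| + height x + height x =
        2 * ((offset a f x).toNat + height x) := by
      rw [abs_of_neg (by omega)]
      omega
    rw [h3]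
    push_cast
    ring
  · rw [lineDist_sub_lineDist_reflect hx.1 h h2, abs_sub_sub_abs_add hx.2.le hy.le, sub_zero]

theorem lineDist_sub_of_offset_neg (hx : x ∈ rightCore a f) (hy : offset a f y < 0)
    (hxy : reflect a f x ≠ y) :
    lineDist x y - lineDist (reflect a f x) y =
      (min (offset a f x).toNat (-offset a f y).toNat : ℕ) := by
  rw [mem_rightCore] at hx
  have h1 : x ≠ y := fun h => by
    rw [h] at hx
    omega
  rw [lineDist_sub_lineDist_reflect hx.1 h1 hxy, ← neg_neg (((min _ _ : ℕ) : ℝ)),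
    ← abs_sub_sub_abs_add hx.2.le (by omega : 0 ≤ -offset a f y), sub_neg_eq_add,
    ← sub_eq_add_neg]
  push_cast
  ring

/-- The difference of the distances to `w_{a+1}` and to `w_f`. -/
noncomputable def shift (a f : ℕ) (x : ℕ ⊕ ℕ) : ℝ := lineDist x (w (a + 1)) - lineDist x (w f)

theorem offset_w_left (a f : ℕ) : offset a f (w (a + 1)) = a + 1 - f := by
  rw [offset, pos_w]
  push_cast
  ring

theorem offset_w_right (a f : ℕ) : offset a f (w f) = f - (a + 1) := by
  rw [offset, pos_w]
  ring

theorem shift_eq (h1 : x ≠ w (a + 1)) (h2 : x ≠ w f) :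
    shift a f x = -((|offset a f x - (f - (a + 1))| - |offset a f x + (f - (a + 1))| : ℤ) : ℝ) /
      2 := by
  rw [shift, lineDist_of_ne_offset (a := a) (f := f) h1,
    lineDist_of_ne_offset (a := a) (f := f) h2, offset_w_left, offset_w_right, height_w, height_w,
    show offset a f x - (a + 1 - f) = offset a f x + (f - (a + 1)) by ring]
  push_cast
  ring

theorem ne_w_of_mem_core (haf : a < f) (hx : x ∈ core a f) : x ≠ w (a + 1) ∧ x ≠ w f := by
  constructor
  · rintro rfl
    rw [w_mem_core] at hx
    omega
  · rintro rfl
    rw [w_mem_core] at hx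
    omega

theorem ne_w_of_mem_tail (haf : a < f) (hx : x ∈ tail a f m) : x ≠ w (a + 1) ∧ x ≠ w f := by
  constructor
  · rintro rfl
    rw [w_mem_tail] at hx
    omega
  · rintro rfl
    rw [w_mem_tail] at hx
    omega

theorem shift_reflect (haf : a < f) (hx : x ∈ core a f) :
    shift a f (reflect a f x) = -shift a f x := by
  obtain ⟨h1, h2⟩ := ne_w_of_mem_core haf hx
  obtain ⟨h3, h4⟩ := ne_w_of_mem_core haf (reflect_mem_core hx)
  rw [shift_eq h1 h2, shift_eq h3 h4, offset_reflect hx, ← neg_add', abs_neg,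
    show -offset a f x + ((f : ℤ) - (a + 1)) = -(offset a f x - (f - (a + 1))) by ring, abs_neg]
  push_cast
  ring

/-- The vertices `w (a + 1)` and `w f` are mirror images, so the shift is itself an antisymmetrized
distance: the kernel `min` with source at the offset of `w f`. -/
theorem shift_of_offset_nonneg (haf : a < f) (h1 : x ≠ w (a + 1)) (h2 : x ≠ w f)
    (hx : 0 ≤ offset a f x) :
    shift a f x = (min (offset a f x).toNat (f - (a + 1)) : ℕ) := by
  rw [shift_eq h1 h2, neg_div, abs_sub_sub_abs_add hx (by omega), neg_neg]
  congr 2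
  omega

/-- The tail lies beyond the source: there the shift takes its full value, and the potential bound
of `exists_minKernel_solution` applies. -/
theorem le_offset_of_mem_tail (haf : a < f) (hx : x ∈ tail a f m) :
    (f - (a + 1) : ℕ) < offset a f x := by
  rcases x with i | i
  · rw [v_mem_tail] at hx
    rw [offset, pos_v]
    omega
  · rw [w_mem_tail] at hx
    rw [offset, pos_w]
    omega

theorem disjoint_core_tail (haf : a < f) : Disjoint (core a f) (tail a f m) := by
  rw [Finset.disjoint_left]
  rintro (i | i) h1 h2
  · rw [v_mem_core] at h1
    rw [v_mem_tail] at h2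
    omega
  · rw [w_mem_core] at h1
    rw [w_mem_tail] at h2
    omega

end Core

/-- A lower bound for the effect of the shift, for an eigenvector of the distance matrix of the
core and the tail together with one further vertex `w₀`. -/
theorem sum_shift_lower_bound {a f m : ℕ} (haf : a < f) (hm : a + f + 2 ≤ m) {w₀ : ℕ ⊕ ℕ}
    {ε ρ : ℝ} (hw₀ : ∀ x ∈ rightCore a f, lineDist x w₀ - lineDist (reflect a f x) w₀ =
      -(ε * (min (offset a f x).toNat (f - (a + 1)) : ℕ)))
    {X : ℕ ⊕ ℕ → ℝ} (hX : ∀ x ∈ tail a f m, 0 < X x)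
    (hρ : ∀ x ∈ core a f, ρ * X x =
      ∑ y ∈ core a f ∪ tail a f m, lineDist x y * X y + lineDist x w₀ * X w₀)
    {z : rightCore a f → ℝ}
    (hz : ∀ q : rightCore a f, (ρ + height q) * z q +
      ∑ p : rightCore a f, ((min (offset a f q).toNat (offset a f p).toNat : ℕ) : ℝ) * z p =
        (min (offset a f q).toNat (f - (a + 1)) : ℕ))
    (hzc : ∀ T, f - (a + 1) ≤ T →
      ∑ p : rightCore a f, ((min T (offset a f p).toNat : ℕ) : ℝ) * z p < (f - (a + 1) : ℕ)) :
    -(ε * X w₀ * ∑ q : rightCore a f, z q * (min (offset a f q).toNat (f - (a + 1)) : ℕ)) <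
      ∑ x ∈ core a f ∪ tail a f m, shift a f x * X x := by
  have hdisj := disjoint_core_tail (m := m) haf
  set δ : ℕ ⊕ ℕ → ℝ := fun x => X x - X (reflect a f x) with hδ
  have hpos : ∀ k ∈ tail a f m, 0 < offset a f k := fun k hk =>
    (Int.natCast_nonneg _).trans_lt (le_offset_of_mem_tail haf hk)
  have hsum : ∑ x ∈ core a f ∪ tail a f m, shift a f x * X x =
      ∑ q : rightCore a f, δ q * (min (offset a f q).toNat (f - (a + 1)) : ℕ) +
        (f - (a + 1) : ℕ) * ∑ k ∈ tail a f m, X k := by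
    rw [Finset.sum_union hdisj, sum_core_odd fun x hx => shift_reflect haf hx, Finset.mul_sum,
      Finset.sum_coe_sort (rightCore a f)
        fun q => δ q * ((min (offset a f q).toNat (f - (a + 1)) : ℕ) : ℝ)]
    congr 1
    · refine Finset.sum_congr rfl fun x hx => ?_
      rw [mem_rightCore] at hx
      obtain ⟨h1, h2⟩ := ne_w_of_mem_core haf hx.1
      rw [shift_of_offset_nonneg haf h1 h2 hx.2.le, mul_comm]
    · refine Finset.sum_congr rfl fun x hx => ?_
      obtain ⟨h1, h2⟩ := ne_w_of_mem_tail haf hx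
      have h3 := le_offset_of_mem_tail haf hx
      rw [shift_of_offset_nonneg haf h1 h2 (hpos x hx).le, min_eq_right (by omega)]
  rw [hsum]
  refine minKernel_lower_bound (K := tail a f m) ⟨v m, v_mem_tail.2 ⟨hm, le_rfl⟩⟩
    (t := fun q : rightCore a f => (offset a f q).toNat) hz hzc
    (τ := fun k => (offset a f k).toNat) (fun k hk => ?_) hX fun q => ?_
  · have := le_offset_of_mem_tail haf hk
    omega
  obtain ⟨x, hx⟩ := q
  have hxc := (mem_rightCore.1 hx).1
  -- Subtracting the eigenequations at `x` and at its mirror image gives the `min` system for `δ`;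
  -- `h3`, `h5` and `h6` are the contributions of core, tail and `w₀`.
  have h1 := hρ x hxc
  have h2 := hρ _ (reflect_mem_core hxc)
  rw [Finset.sum_union hdisj] at h1 h2
  have h3 : ∑ y ∈ core a f, lineDist x y * X y -
      ∑ y ∈ core a f, lineDist (reflect a f x) y * X y =
        -∑ p : rightCore a f, ((min (offset a f x).toNat (offset a f p).toNat : ℕ) : ℝ) * δ p -
          height x * δ x := by
    rw [← Finset.sum_sub_distrib, Finset.sum_coe_sort (rightCore a f)
      fun p => ((min (offset a f x).toNat (offset a f p).toNat : ℕ) : ℝ) * δ p]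
    simp only [← sub_mul]
    rw [sum_core_odd (g := fun y => lineDist x y - lineDist (reflect a f x) y) fun y hy => by
      rw [lineDist_reflect_right hxc hy, lineDist_reflect_reflect hxc hy, neg_sub]]
    have h4 : ∀ y ∈ rightCore a f,
        (lineDist x y - lineDist (reflect a f x) y) * (X y - X (reflect a f y)) =
          -(((min (offset a f x).toNat (offset a f y).toNat : ℕ) : ℝ) * δ y) -
            if x = y then height x * δ x else 0 := fun y hy => by
      rw [lineDist_sub_of_offset_pos hx (mem_rightCore.1 hy).2]
      split_ifs with h
      · subst h
        rw [hδ]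
        ring
      · rw [hδ]
        ring
    rw [Finset.sum_congr rfl h4, Finset.sum_sub_distrib, Finset.sum_neg_distrib,
      Finset.sum_ite_eq, if_pos hx]
  have h5 : ∑ y ∈ tail a f m, lineDist x y * X y -
      ∑ y ∈ tail a f m, lineDist (reflect a f x) y * X y =
        -∑ k ∈ tail a f m, ((min (offset a f x).toNat (offset a f k).toNat : ℕ) : ℝ) * X k := by
    rw [← Finset.sum_sub_distrib, ← Finset.sum_neg_distrib]
    refine Finset.sum_congr rfl fun k hk => ?_
    have hne : x ≠ k := fun h => Finset.disjoint_left.1 hdisj hxc (h ▸ hk)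
    rw [← sub_mul, lineDist_sub_of_offset_pos hx (hpos k hk), if_neg hne, sub_zero, neg_mul]
  have h6 := hw₀ x hx
  simp only [hδ] at h3 ⊢
  linear_combination h1 - h2 + h3 + h5 + X w₀ * h6

/-! ### Comparison of the two hypertrees -/

/-- Comparison of eigenvalues of two symmetric matrices that differ in the row and column of one
vertex. -/
theorem sub_mul_inner_eq {α : Type*} {D : α → α → ℝ} (hD : ∀ x y, D x y = D y x) (R : Finset α)
    {p q : α} {X Y : α → ℝ} {ρ σ : ℝ}
    (hX : ∀ x ∈ R, ρ * X x = ∑ y ∈ R, D x y * X y + D x p * X p)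
    (hXp : ρ * X p = ∑ y ∈ R, D p y * X y)
    (hY : ∀ x ∈ R, σ * Y x = ∑ y ∈ R, D x y * Y y + D x q * Y q)
    (hYq : σ * Y q = ∑ y ∈ R, D q y * Y y) :
    (σ - ρ) * (∑ x ∈ R, X x * Y x + X p * Y q) =
      Y q * ∑ x ∈ R, (D x q - D x p) * X x + X p * ∑ x ∈ R, (D x q - D x p) * Y x := by
  have h1 : ρ * ∑ x ∈ R, X x * Y x =
      ∑ x ∈ R, Y x * ∑ y ∈ R, D x y * X y + X p * ∑ x ∈ R, D x p * Y x := by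
    rw [Finset.mul_sum, Finset.mul_sum, ← Finset.sum_add_distrib]
    exact Finset.sum_congr rfl fun x hx => by linear_combination Y x * hX x hx
  have h2 : σ * ∑ x ∈ R, X x * Y x =
      ∑ x ∈ R, X x * ∑ y ∈ R, D x y * Y y + Y q * ∑ x ∈ R, D x q * X x := by
    rw [Finset.mul_sum, Finset.mul_sum, ← Finset.sum_add_distrib]
    exact Finset.sum_congr rfl fun x hx => by linear_combination X x * hY x hx
  have h3 : ∑ x ∈ R, Y x * ∑ y ∈ R, D x y * X y = ∑ x ∈ R, X x * ∑ y ∈ R, D x y * Y y := by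
    simp only [Finset.mul_sum]
    rw [Finset.sum_comm]
    exact Finset.sum_congr rfl fun x _ => Finset.sum_congr rfl fun y _ => by
      rw [hD]
      ring
  simp only [hD p, hD q] at hXp hYq
  simp only [sub_mul, Finset.sum_sub_distrib]
  linear_combination h2 - h1 - h3 + X p * hYq - Y q * hXp

/-- With f = n - a - 2b, the right block of inserted indices begins at f here and at f + 1 after the
change of parameters, while its end and the path length depend only on a + b. -/
theorem mem_vertexSet_left {n a b : ℕ} (hn : 2 * (a + b) < n - 1) (hab : a + 2 ≤ b)
    (x : ℕ ⊕ ℕ) :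
    x ∈ insert (w (n - a - 2 * b)) (core a (n - a - 2 * b) ∪ tail a (n - a - 2 * b) (n - a - b)) ↔
      x ∈ V(pathHypertree n a b) := by
  rw [mem_vertexSet_iff, Finset.mem_insert, Finset.mem_union]
  rcases x with i | i
  · simp only [v_mem_core, v_mem_tail, reduceCtorEq, false_or, and_false, exists_false, or_false,
      Sum.inl.injEq, ← and_assoc, exists_eq_right']
    omega
  · simp only [w_mem_core, w_mem_tail, reduceCtorEq, and_false, exists_false, false_or,
      Sum.inr.injEq, exists_eq_right', insertIndices, Set.mem_union, Set.mem_Icc]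
    omega

theorem mem_vertexSet_right {n a b : ℕ} (hn : 2 * (a + b) < n - 1) (hab : a + 2 ≤ b)
    (x : ℕ ⊕ ℕ) :
    x ∈ insert (w (a + 1)) (core a (n - a - 2 * b) ∪ tail a (n - a - 2 * b) (n - a - b)) ↔
      x ∈ V(pathHypertree n (a + 1) (b - 1)) := by
  rw [mem_vertexSet_iff, Finset.mem_insert, Finset.mem_union]
  rcases x with i | i
  · simp only [v_mem_core, v_mem_tail, reduceCtorEq, false_or, and_false, exists_false, or_false,
      Sum.inl.injEq, ← and_assoc, exists_eq_right']
    omega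
  · simp only [w_mem_core, w_mem_tail, reduceCtorEq, and_false, exists_false, false_or,
      Sum.inr.injEq, exists_eq_right', insertIndices, Set.mem_union, Set.mem_Icc]
    omega

end PathHypertree

open PathHypertree in
theorem mainTheorem4 (n a b : ℕ) (hab : a + 2 ≤ b) (hn : 2 * (a + b) < n - 1) :
    (pathHypertree n (a + 1) (b - 1)).distSpectralRadius >
      (pathHypertree n a b).distSpectralRadius := by
  have hV := mem_vertexSet_left hn hab
  have hV' := mem_vertexSet_right hn hab
  obtain ⟨f, hf⟩ : ∃ f, f = n - a - 2 * b := ⟨_, rfl⟩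
  obtain ⟨m, hm⟩ : ∃ m, m = n - a - b := ⟨_, rfl⟩
  rw [← hf, ← hm] at hV hV'
  have haf : a < f := by omega
  -- This number is n - 2(a + b) - 1; its positivity is exactly the strict inequality `hn`.
  have hc : 0 < f - (a + 1) := by omega
  -- Since m - a - f = b - a, the gap `hab` is what makes the tail nonempty.
  have hfm : a + f + 2 ≤ m := by omega
  have hv : v 1 ∈ core a f ∪ tail a f m :=
    Finset.mem_union_left _ (v_mem_core.2 ⟨le_rfl, by omega⟩)
  have hR : ∀ x ∈ core a f ∪ tail a f m, x ≠ w (a + 1) ∧ x ≠ w f := fun x hx =>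
    (Finset.mem_union.1 hx).elim (ne_w_of_mem_core haf) (ne_w_of_mem_tail haf)
  have hp : w f ∉ core a f ∪ tail a f m := fun h => (hR _ h).2 rfl
  have hq : w (a + 1) ∉ core a f ∪ tail a f m := fun h => (hR _ h).1 rfl
  obtain ⟨hρ, X, hX, hXe⟩ := exists_pos_eigenfunction (by omega) hV
    ⟨w f, Finset.mem_insert_self _ _, v 1, Finset.mem_insert_of_mem hv, Sum.inr_ne_inl⟩
  obtain ⟨hσ, Y, hY, hYe⟩ := exists_pos_eigenfunction (by omega) hV'
    ⟨w (a + 1), Finset.mem_insert_self _ _, v 1, Finset.mem_insert_of_mem hv, Sum.inr_ne_inl⟩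
  generalize (pathHypertree n a b).distSpectralRadius = ρ at *
  generalize (pathHypertree n (a + 1) (b - 1)).distSpectralRadius = σ at *
  rw [gt_iff_lt]
  by_contra hle
  rw [not_lt] at hle
  simp only [Finset.sum_insert hp, Finset.sum_insert hq, Finset.forall_mem_insert, lineDist_self,
    zero_mul, zero_add] at hX hXe hY hYe
  have hXe' : ∀ x ∈ core a f ∪ tail a f m, ρ * X x =
      ∑ y ∈ core a f ∪ tail a f m, lineDist x y * X y + lineDist x (w f) * X (w f) :=
    fun x hx => by rw [hXe.2 x hx, add_comm]
  have hYe' : ∀ x ∈ core a f ∪ tail a f m, σ * Y x =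
      ∑ y ∈ core a f ∪ tail a f m, lineDist x y * Y y + lineDist x (w (a + 1)) * Y (w (a + 1)) :=
    fun x hx => by rw [hYe.2 x hx, add_comm]
  have hkey := sub_mul_inner_eq lineDist_comm (core a f ∪ tail a f m) hXe' hXe.1 hYe' hYe.1
  have hh : ∀ q : rightCore a f, (0 : ℝ) ≤ height q := fun q => by exact_mod_cast height_nonneg _
  obtain ⟨z, hz0, hz, hzc⟩ := exists_minKernel_solution
    (fun q : rightCore a f => (offset a f q).toNat) (r := fun q => ρ + height q)
    (fun q => add_pos_of_pos_of_nonneg hρ (hh q)) hc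
  obtain ⟨z', hz0', hz', hzc'⟩ := exists_minKernel_solution
    (fun q : rightCore a f => (offset a f q).toNat) (r := fun q => σ + height q)
    (fun q => add_pos_of_pos_of_nonneg hσ (hh q)) hc
  have hmono := minKernel_mono (fun q => by linarith) hz0 hz0' hz hz'
  -- The signs 1 and -1 of ε record that `w f` lies to the right of the centre and `w (a + 1)` to
  -- the left.
  have h1 := sum_shift_lower_bound (w₀ := w f) (ε := 1) haf hfm (fun x hx => by
      rw [lineDist_sub_of_offset_pos hx (by rw [offset_w_right]; omega),
        if_neg (ne_w_of_mem_core haf (mem_rightCore.1 hx).1).2, offset_w_right, sub_zero, one_mul,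
        show ((f : ℤ) - (a + 1)).toNat = f - (a + 1) by omega])
    (fun x hx => hX.2 x (Finset.mem_union_right _ hx))
    (fun x hx => hXe' x (Finset.mem_union_left _ hx)) hz hzc
  have h2 := sum_shift_lower_bound (w₀ := w (a + 1)) (ε := -1) haf hfm (fun x hx => by
      rw [lineDist_sub_of_offset_neg hx (by rw [offset_w_left]; omega)
          (ne_w_of_mem_core haf (reflect_mem_core (mem_rightCore.1 hx).1)).1, offset_w_left,
        show (-((a : ℤ) + 1 - f)).toNat = f - (a + 1) by omega, neg_one_mul, neg_neg])
    (fun x hx => hY.2 x (Finset.mem_union_right _ hx))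
    (fun x hx => hYe' x (Finset.mem_union_left _ hx)) hz' hzc'
  have hI : 0 ≤ ∑ x ∈ core a f ∪ tail a f m, X x * Y x + X (w f) * Y (w (a + 1)) :=
    add_nonneg (Finset.sum_nonneg fun x hx => (mul_pos (hX.2 x hx) (hY.2 x hx)).le)
      (mul_pos hX.1 hY.1).le
  have h3 := mul_nonpos_of_nonpos_of_nonneg (sub_nonpos.2 hle) hI
  rw [hkey] at h3
  have h4 := mul_lt_mul_of_pos_left h1 hY.1
  have h5 := mul_lt_mul_of_pos_left h2 hX.1
  have h6 := mul_le_mul_of_nonneg_left hmono (mul_pos hX.1 hY.1).le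
  simp only [shift] at h4 h5
  linarith
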